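/- Let $m\ge 0$ be an integer and let $V$ be a random variable with values in $\mathbb N$. For each $i\in\mathbb N$ let $d_i\in\{0,1,\dots,m\}$, let $U_i$ be a real orthogonal $m\times m$ matrix, let $\mathbf b_i\in\mathbb R^m$, and let $\mathbf C_i$ be an $\mathbb R^{d_i}$-valued random vector, defined on the same probability space as $V$, whose law is absolutely continuous with respect to Lebesgue measure on $\mathbb R^{d_i}$ (for $d_i=0$ this is no condition). No independence among $V$ and the $\mathbf C_i$ is assumed. Put $$\mathbf Z^{(i)}=U_i\,(\mathbf C_i^T,\underbrace{0,\dots,0}_{m-d_i})^T+\mathbf b_i,\qquad \mathbf Z^m=\sum_{i\in\mathbb N}\mathbf 1_{\{V=i\}}\,\mathbf Z^{(i)} .$$ For $\mathbf x\in\mathbb R^m$ and an integer $n\ge 1$ let $[\mathbf x]_n=\big(\lfloor n x_1\rfloor/n,\dots,\lfloor n x_m\rfloor/n\big)$, and let $H$ denote Shannon entropy. Suppose that $H(V)<\infty$ and that $H([\mathbf Z^m]_1)<\infty$. Then the Rényi information dimension of $\mathbf Z^m$ exists and equals the expectation of $d_V$: $$d(\mathbf Z^m)=\lim_{n\to\infty}\frac{H([\mathbf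 Z^m]_n)}{\log n}=\mathbb E[d_V].$$ -/

import Mathlib

open MeasureTheory Filter Topology
open scoped ENNReal

noncomputable section

/-- Shannon entropy `H(X) = ∑ₛ -P(X = s) log P(X = s)` of a discrete random variable `X`
(one with countably many values), with value `∞` when the series diverges. -/
def shannonEntropy {Ω S : Type*} [MeasurableSpace Ω] (μ : Measure Ω) (X : Ω → S) : ℝ≥0∞ :=
  ∑' s : S, ENNReal.ofReal (Real.negMulLog (μ.real (X ⁻¹' {s})))

/-- Uniform quantization with precision `n`: the coordinates of `[x]ₙ` are `⌊n xⱼ⌋ / n`. -/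
def quantize {m : ℕ} (n : ℕ) (x : Fin m → ℝ) : Fin m → ℝ :=
  fun j => (⌊(n : ℝ) * x j⌋ : ℝ) / (n : ℝ)

/-- `HasInformationDimension μ X δ`: the limit of `H([X]ₙ) / log n` as `n → ∞` exists in `[0, ∞]`
and equals `δ`, i.e. the Rényi information dimension of the random vector `X` is `δ`. -/
def HasInformationDimension {Ω : Type*} [MeasurableSpace Ω] (μ : Measure Ω) {m : ℕ}
    (X : Ω → Fin m → ℝ) (δ : ℝ≥0∞) : Prop :=
  Tendsto (fun n : ℕ => shannonEntropy μ (fun ω => quantize n (X ω)) /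
    ENNReal.ofReal (Real.log n)) atTop (𝓝 δ)

/-- The vector `(c₁, …, c_d, 0, …, 0)` of length `m`, for `d ≤ m`. -/
def zeroPad {d : ℕ} (m : ℕ) (c : Fin d → ℝ) : Fin m → ℝ :=
  fun j => if h : (j : ℕ) < d then c ⟨j, h⟩ else 0

/-- The component `Z⁽ⁱ⁾ = U (Cᵀ, 0, …, 0)ᵀ + b`, with values in an affine subset of `ℝᵐ`. -/
def affineComponent {Ω : Type*} {m d : ℕ} (U : Matrix.orthogonalGroup (Fin m) ℝ)
    (b : Fin m → ℝ) (C : Ω → Fin d → ℝ) : Ω → Fin m → ℝ :=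
  fun ω => (U : Matrix (Fin m) (Fin m) ℝ).mulVec (zeroPad m (C ω)) + b

/-- The affinely singular random vector `Z = ∑ᵢ 1_{V = i} Z⁽ⁱ⁾`; for each `ω` exactly one term of
the sum can be nonzero. -/
def affinelySingularVector {Ω : Type*} {m : ℕ} (V : Ω → ℕ) (d : ℕ → ℕ)
    (U : ℕ → Matrix.orthogonalGroup (Fin m) ℝ) (b : ℕ → Fin m → ℝ)
    (C : (i : ℕ) → Ω → Fin (d i) → ℝ) : Ω → Fin m → ℝ :=
  fun ω => ∑' i : ℕ, (V ⁻¹' {i}).indicator (affineComponent (U i) (b i) (C i)) ω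

end

/-! Write `K n` for the integer index of the cube of side `1 / n` containing `Z`; `H(K n)` is
squeezed between two affine functions of `log n`.

Upper bound: adjoining `V` can only increase entropy. Given `V = i` and the unit cube of `Z`, the `d
i`-dimensional affine piece meets at most `const * n ^ d i` small cubes, so `H(K n) ≤ H(V) + H(K 1)
+ const + 𝔼[d V] log n` (`shannonEntropy_le_comp_add_log_card`,
`exists_finset_floorVec_affineComponent_mem`).

Lower bound: where the density of `C V` is at most `M`, each atom of `(V, K n)` with `V = i` has
mass at most `const * M / n ^ d i`. Small atoms force large entropy, so `𝔼[d V; density ≤ M] log n ≤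
H(K n) + H(V) + const(M)` (`setLIntegral_le_shannonEntropy_add`, `measure_densityLeEvent_le`).
Divide by `log n`, let `n → ∞`, then `M → ∞`; the truncation events exhaust the space almost surely.
-/

/-- Gibbs' inequality in pointwise form. -/
theorem negMulLog_add_le_mul_neg_log_add {a c : ℝ} (ha : 0 ≤ a) (hc : 0 ≤ c) (h : c = 0 → a = 0) :
    Real.negMulLog a + a ≤ a * (-Real.log c) + c := by
  rcases ha.eq_or_lt with rfl | ha'
  · simpa using hc
  have hc' : 0 < c := lt_of_le_of_ne hc fun h0 => ha'.ne' (h h0.symm)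
  have h1 := Real.log_le_sub_one_of_pos (div_pos hc' ha')
  rw [Real.log_div hc'.ne' ha'.ne'] at h1
  have h2 := mul_le_mul_of_nonneg_left h1 ha
  have h3 : a * (c / a - 1) = c - a := by field_simp
  rw [h3] at h2
  simp only [Real.negMulLog]
  linarith

/-! ### Entropy inequalities for countably valued variables. -/

section Entropy

variable {Ω : Type*} [MeasurableSpace Ω] (μ : Measure Ω)

theorem shannonEntropy_comp_of_injective {S T : Type*} (X : Ω → S) {g : S → T}
    (hg : Function.Injective g) :
    shannonEntropy μ (fun ω => g (X ω)) = shannonEntropy μ X := by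
  unfold shannonEntropy
  rw [← hg.tsum_eq]
  · refine tsum_congr fun s => ?_
    congr 4
    ext ω
    simp [hg.eq_iff]
  · intro t ht
    by_contra h
    apply ht
    have : (fun ω => g (X ω)) ⁻¹' {t} = ∅ := by
      ext ω
      simp only [Set.mem_preimage, Set.mem_singleton_iff, Set.mem_empty_iff_false, iff_false]
      exact fun h' => h ⟨_, h'⟩
    simp [this]

variable {S T : Type*} [MeasurableSpace S] [MeasurableSingletonClass S] [Countable S]
  [MeasurableSpace T] [MeasurableSingletonClass T] [Countable T]

theorem tsum_mul_measure_preimage_singleton {Y : Ω → T} (hY : Measurable Y) (φ : T → ℝ≥0∞) :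
    ∑' t, φ t * μ (Y ⁻¹' {t}) = ∫⁻ ω, φ (Y ω) ∂μ := by
  rw [← lintegral_map (measurable_of_countable φ) hY, lintegral_countable']
  exact tsum_congr fun t => by rw [Measure.map_apply hY (measurableSet_singleton t)]

theorem tsum_measure_preimage_singleton_eq {Y : Ω → T} (hY : Measurable Y) :
    ∑' t, μ (Y ⁻¹' {t}) = μ Set.univ := by
  simpa using tsum_mul_measure_preimage_singleton μ hY 1

variable [IsProbabilityMeasure μ]

theorem neg_log_measureReal_nonneg (s : Set Ω) : 0 ≤ -Real.log (μ.real s) :=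
  neg_nonneg.2 (Real.log_nonpos measureReal_nonneg measureReal_le_one)

theorem shannonEntropy_eq_lintegral {Y : Ω → T} (hY : Measurable Y) :
    shannonEntropy μ Y = ∫⁻ ω, ENNReal.ofReal (-Real.log (μ.real (Y ⁻¹' {Y ω}))) ∂μ := by
  rw [← tsum_mul_measure_preimage_singleton μ hY
    (fun t => ENNReal.ofReal (-Real.log (μ.real (Y ⁻¹' {t}))))]
  refine tsum_congr fun t => ?_
  rw [← ofReal_measureReal, ← ENNReal.ofReal_mul (neg_log_measureReal_nonneg μ _)]
  congr 1
  simp only [Real.negMulLog]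
  ring

/-- Each atom of `g ∘ Y` contains the corresponding atom of `Y`, so its information `-log` is
pointwise smaller. -/
theorem shannonEntropy_comp_le {Y : Ω → T} (hY : Measurable Y) (g : T → S) :
    shannonEntropy μ (fun ω => g (Y ω)) ≤ shannonEntropy μ Y := by
  have hgY : Measurable (fun ω => g (Y ω)) := (measurable_of_countable g).comp hY
  rw [shannonEntropy_eq_lintegral μ hY, shannonEntropy_eq_lintegral μ hgY]
  -- Since `Real.log 0 = 0`, monotonicity of `log` fails at null atoms; these are almost surely
  -- avoided.
  have h0 : ∀ᵐ ω ∂μ, μ (Y ⁻¹' {Y ω}) ≠ 0 := by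
    have : ∀ t, ∀ᵐ ω ∂μ, Y ω = t → μ (Y ⁻¹' {t}) ≠ 0 := by
      intro t
      by_cases h : μ (Y ⁻¹' {t}) = 0
      · filter_upwards [measure_eq_zero_iff_ae_notMem.1 h] with ω hω h'
        exact absurd h' hω
      · exact ae_of_all _ fun _ _ => h
    filter_upwards [ae_all_iff.2 this] with ω hω using hω _ rfl
  refine lintegral_mono_ae ?_
  filter_upwards [h0] with ω hω
  refine ENNReal.ofReal_le_ofReal (neg_le_neg (Real.log_le_log ?_ ?_))
  · exact ENNReal.toReal_pos hω (measure_ne_top _ _)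
  · refine measureReal_mono ?_
    intro ω' h'
    simp only [Set.mem_preimage, Set.mem_singleton_iff] at h' ⊢
    rw [h']

/-- Comparison of the entropy of `Y` with the cross entropy to a sub-probability `c`. -/
theorem shannonEntropy_le_tsum_mul_neg_log {Y : Ω → T} (hY : Measurable Y) (c : T → ℝ)
    (hc0 : ∀ t, 0 ≤ c t) (hc1 : ∀ t, c t ≤ 1) (hc : ∀ t, c t = 0 → μ (Y ⁻¹' {t}) = 0)
    (hsum : ∑' t, ENNReal.ofReal (c t) ≤ 1) :
    shannonEntropy μ Y ≤ ∫⁻ ω, ENNReal.ofReal (-Real.log (c (Y ω))) ∂μ := by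
  have h1 : ∀ t, ENNReal.ofReal (Real.negMulLog (μ.real (Y ⁻¹' {t}))) + μ (Y ⁻¹' {t}) ≤
      ENNReal.ofReal (-Real.log (c t)) * μ (Y ⁻¹' {t}) + ENNReal.ofReal (c t) := by
    intro t
    have hl : 0 ≤ -Real.log (c t) := neg_nonneg.2 (Real.log_nonpos (hc0 t) (hc1 t))
    have hr : 0 ≤ μ.real (Y ⁻¹' {t}) := measureReal_nonneg
    rw [← ofReal_measureReal (s := Y ⁻¹' {t}), ← ENNReal.ofReal_mul hl,
      ← ENNReal.ofReal_add (Real.negMulLog_nonneg hr measureReal_le_one) hr,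
      ← ENNReal.ofReal_add (mul_nonneg hl hr) (hc0 t)]
    refine ENNReal.ofReal_le_ofReal ?_
    rw [mul_comm (-Real.log (c t))]
    exact negMulLog_add_le_mul_neg_log_add hr (hc0 t) fun h => by simp [Measure.real, hc t h]
  have h2 := ENNReal.tsum_le_tsum h1
  rw [ENNReal.tsum_add, ENNReal.tsum_add, tsum_measure_preimage_singleton_eq μ hY, measure_univ,
    tsum_mul_measure_preimage_singleton μ hY (fun t => ENNReal.ofReal (-Real.log (c t)))] at h2
  -- The extra terms of Gibbs' inequality sum to exactly 1 on the left and at most 1 on the right,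
  -- so they cancel without any subtraction in `ℝ≥0∞`.
  exact (ENNReal.add_le_add_iff_right ENNReal.one_ne_top).1 (h2.trans (by gcongr))

/-- Cross entropy against the product of the marginals, whose logarithm splits. -/
theorem shannonEntropy_prodMk_le {X : Ω → S} {Y : Ω → T} (hX : Measurable X) (hY : Measurable Y) :
    shannonEntropy μ (fun ω => (X ω, Y ω)) ≤ shannonEntropy μ X + shannonEntropy μ Y := by
  have hle : ∀ t : S × T, μ ((fun ω => (X ω, Y ω)) ⁻¹' {t}) ≤ μ (X ⁻¹' {t.1}) ∧
      μ ((fun ω => (X ω, Y ω)) ⁻¹' {t}) ≤ μ (Y ⁻¹' {t.2}) := by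
    rintro ⟨s, t⟩
    constructor <;> refine measure_mono ?_ <;> intro ω <;> simp +contextual
  have hz : ∀ s : Set Ω, μ.real s = 0 → μ s = 0 := fun s h => (measureReal_eq_zero_iff).1 h
  refine (shannonEntropy_le_tsum_mul_neg_log μ (hX.prodMk hY)
    (fun t => μ.real (X ⁻¹' {t.1}) * μ.real (Y ⁻¹' {t.2})) (fun t => by positivity)
    (fun t => mul_le_one₀ measureReal_le_one measureReal_nonneg measureReal_le_one) ?_ ?_).trans ?_
  · intro t ht
    rcases mul_eq_zero.1 ht with h | h
    · exact le_antisymm ((hle t).1.trans (hz _ h).le) zero_le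
    · exact le_antisymm ((hle t).2.trans (hz _ h).le) zero_le
  · have hr : ∀ s, ENNReal.ofReal (μ.real s) = μ s := fun _ => ofReal_measureReal
    simp_rw [ENNReal.ofReal_mul measureReal_nonneg, hr]
    rw [ENNReal.tsum_prod (f := fun s t => μ (X ⁻¹' {s}) * μ (Y ⁻¹' {t}))]
    simp_rw [ENNReal.tsum_mul_left, tsum_measure_preimage_singleton_eq μ hY, measure_univ, mul_one]
    rw [tsum_measure_preimage_singleton_eq μ hX, measure_univ]
  · rw [shannonEntropy_eq_lintegral μ hX, shannonEntropy_eq_lintegral μ hY, ← lintegral_add_left]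
    · refine lintegral_mono fun ω => ?_
      rw [← ENNReal.ofReal_add (neg_log_measureReal_nonneg μ _) (neg_log_measureReal_nonneg μ _)]
      by_cases h : μ.real (X ⁻¹' {X ω}) = 0
      · simp [h]
      by_cases h' : μ.real (Y ⁻¹' {Y ω}) = 0
      · simp [h']
      · rw [Real.log_mul h h', neg_add]
    · exact (measurable_of_countable
        (fun s => ENNReal.ofReal (-Real.log (μ.real (X ⁻¹' {s}))))).comp hX

/-- If, given `g ∘ Y = s`, the variable `Y` takes at most `N s` values, then
`H(Y) ≤ H(g ∘ Y) + 𝔼 [log N (g ∘ Y)]`. -/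
theorem shannonEntropy_le_comp_add_log_card {Y : Ω → T} (hY : Measurable Y) (g : T → S)
    (F : S → Finset T) (N : S → ℝ) (hN : ∀ s, 1 ≤ N s) (hF : ∀ s, ((F s).card : ℝ) ≤ N s)
    (hYF : ∀ ω, Y ω ∈ F (g (Y ω))) :
    shannonEntropy μ Y ≤ shannonEntropy μ (fun ω => g (Y ω)) +
      ∫⁻ ω, ENNReal.ofReal (Real.log (N (g (Y ω)))) ∂μ := by
  classical
  have hgY : Measurable (fun ω => g (Y ω)) := (measurable_of_countable g).comp hY
  have hN0 : ∀ s, 0 < N s := fun s => one_pos.trans_le (hN s)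
  set p : S → ℝ := fun s => μ.real ((fun ω => g (Y ω)) ⁻¹' {s}) with hp
  have hp0 : ∀ s, 0 ≤ p s := fun s => measureReal_nonneg
  have hpN : ∀ s, p s / N s ≤ 1 := fun s =>
    (div_le_one (hN0 s)).2 (measureReal_le_one.trans (hN s))
  -- The reference weights spread the mass `p s` evenly over `F s`, with `N s` standing in for the
  -- cardinality.
  refine (shannonEntropy_le_tsum_mul_neg_log μ hY
    (fun t => if t ∈ F (g t) then p (g t) / N (g t) else 0) ?_ ?_ ?_ ?_).trans ?_
  · intro t
    split_ifs
    exacts [div_nonneg (hp0 _) (hN0 _).le, le_rfl]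
  · intro t
    split_ifs
    exacts [hpN _, zero_le_one]
  · intro t ht
    split_ifs at ht with h
    · have h0 : μ ((fun ω => g (Y ω)) ⁻¹' {g t}) = 0 := by
        have := (div_eq_zero_iff.1 ht).resolve_right (hN0 _).ne'
        simpa [hp, Measure.real, ENNReal.toReal_eq_zero_iff] using this
      refine measure_mono_null ?_ h0
      intro ω hω
      simp only [Set.mem_preimage, Set.mem_singleton_iff] at hω ⊢
      rw [hω]
    · have : Y ⁻¹' {t} = ∅ := by
        ext ω
        simp only [Set.mem_preimage, Set.mem_singleton_iff, Set.mem_empty_iff_false, iff_false]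
        rintro rfl
        exact h (hYF ω)
      simp [this]
  · calc ∑' t, ENNReal.ofReal (if t ∈ F (g t) then p (g t) / N (g t) else 0)
        ≤ ∑' t, ∑' s, if t ∈ F s then ENNReal.ofReal (p s / N s) else 0 := by
          refine ENNReal.tsum_le_tsum fun t => le_trans ?_ (ENNReal.le_tsum (g t))
          split_ifs <;> simp
      _ = ∑' s, ∑' t, if t ∈ F s then ENNReal.ofReal (p s / N s) else 0 := ENNReal.tsum_comm
      _ ≤ ∑' s, μ ((fun ω => g (Y ω)) ⁻¹' {s}) := by
          refine ENNReal.tsum_le_tsum fun s => ?_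
          rw [tsum_eq_sum (s := F s) (fun t ht => if_neg ht),
            Finset.sum_congr rfl (fun t ht => if_pos ht), Finset.sum_const, nsmul_eq_mul,
            ← ofReal_measureReal (s := (fun ω => g (Y ω)) ⁻¹' {s}), ← ENNReal.ofReal_natCast,
            ← ENNReal.ofReal_mul (Nat.cast_nonneg _)]
          refine ENNReal.ofReal_le_ofReal ?_
          calc ((F s).card : ℝ) * (p s / N s) ≤ N s * (p s / N s) :=
                mul_le_mul_of_nonneg_right (hF s) (div_nonneg (hp0 _) (hN0 _).le)
            _ = p s := by have := (hN0 s).ne'; field_simp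
      _ = 1 := by rw [tsum_measure_preimage_singleton_eq μ hgY, measure_univ]
  · rw [shannonEntropy_eq_lintegral μ hgY, ← lintegral_add_left]
    · refine lintegral_mono fun ω => ?_
      rw [if_pos (hYF ω),
        ← ENNReal.ofReal_add (neg_log_measureReal_nonneg μ _) (Real.log_nonneg (hN _))]
      by_cases h : p (g (Y ω)) = 0
      · simp [h]
      · rw [Real.log_div h (hN0 _).ne']
        refine ENNReal.ofReal_le_ofReal (le_of_eq ?_)
        simp only [hp]
        ring
    · exact (measurable_of_countable (fun s => ENNReal.ofReal (-Real.log (p s)))).comp hgY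

/-- If on the event `A` the atoms of `Y` have mass at most `exp (c - D)`, then
`𝔼 [D(Y); A] ≤ H(Y) + 1 + c`. -/
theorem setLIntegral_le_shannonEntropy_add {Y : Ω → T} (hY : Measurable Y) {A : Set Ω}
    (D : T → ℝ) (hD : ∀ t, 0 ≤ D t) {c : ℝ} (hc : 0 ≤ c)
    (hA : ∀ t, μ.real (Y ⁻¹' {t} ∩ A) ≤ Real.exp (c - D t)) :
    ∫⁻ ω in A, ENNReal.ofReal (D (Y ω)) ∂μ ≤ shannonEntropy μ Y + 1 + ENNReal.ofReal c := by
  have h1 : ∀ t, ENNReal.ofReal (D t) * μ.restrict A (Y ⁻¹' {t}) ≤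
      ENNReal.ofReal (Real.negMulLog (μ.real (Y ⁻¹' {t}))) + μ (Y ⁻¹' {t}) +
        ENNReal.ofReal c * μ (Y ⁻¹' {t}) := by
    intro t
    rw [Measure.restrict_apply (hY (measurableSet_singleton t)),
      ← ofReal_measureReal (s := Y ⁻¹' {t}), ← ofReal_measureReal (s := Y ⁻¹' {t} ∩ A)]
    have ha0 : 0 ≤ μ.real (Y ⁻¹' {t} ∩ A) := measureReal_nonneg
    have hab : μ.real (Y ⁻¹' {t} ∩ A) ≤ μ.real (Y ⁻¹' {t}) :=
      measureReal_mono Set.inter_subset_left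
    have hl := neg_log_measureReal_nonneg μ (Y ⁻¹' {t})
    have hb1 : μ.real (Y ⁻¹' {t}) ≤ 1 := measureReal_le_one
    have hAt := hA t
    generalize μ.real (Y ⁻¹' {t} ∩ A) = a at *
    generalize μ.real (Y ⁻¹' {t}) = b at *
    have hb0 := ha0.trans hab
    rw [← ENNReal.ofReal_mul (hD t), ← ENNReal.ofReal_mul hc,
      ← ENNReal.ofReal_add (Real.negMulLog_nonneg hb0 hb1) hb0,
      ← ENNReal.ofReal_add (add_nonneg (Real.negMulLog_nonneg hb0 hb1) hb0) (mul_nonneg hc hb0)]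
    refine ENNReal.ofReal_le_ofReal ?_
    -- Here `b` is the mass of the atom and `a ≤ b` that of its part in `A`. Gibbs bounds `-a log a`
    -- by `-b log b + b`, while `a ≤ exp (c - D)` bounds it below by `a (D - c)`.
    have hg := negMulLog_add_le_mul_neg_log_add ha0 hb0 fun h => le_antisymm (hab.trans h.le) ha0
    have h2 : a * (-Real.log b) ≤ b * (-Real.log b) := mul_le_mul_of_nonneg_right hab hl
    have h3 : a * (D t - c) ≤ Real.negMulLog a := by
      rcases ha0.eq_or_lt with rfl | ha
      · simp
      · have := (Real.log_le_log ha hAt).trans_eq (Real.log_exp _)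
        have := mul_le_mul_of_nonneg_left this ha0
        simp only [Real.negMulLog]
        linarith
    have h4 := mul_le_mul_of_nonneg_left hab hc
    simp only [Real.negMulLog] at *
    nlinarith
  have h2 := ENNReal.tsum_le_tsum h1
  rwa [tsum_mul_measure_preimage_singleton _ hY (fun t => ENNReal.ofReal (D t)), ENNReal.tsum_add,
    ENNReal.tsum_add, ENNReal.tsum_mul_left, tsum_measure_preimage_singleton_eq μ hY,
    measure_univ, mul_one] at h2

end Entropy

/-! ### Cube counting and cell volumes for affine pieces. -/

section Geometry

variable {m d : ℕ}

theorem abs_zeroPad_sub_le {c c' : Fin d → ℝ} {r : ℝ} (hr : 0 ≤ r) (h : ∀ i, |c i - c' i| ≤ r)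
    (j : Fin m) : |zeroPad m c j - zeroPad m c' j| ≤ r := by
  unfold zeroPad
  split_ifs
  · exact h _
  · simpa using hr

theorem abs_mulVec_le_of_abs_entry_le_one {A : Matrix (Fin m) (Fin m) ℝ} (hA : ∀ i j, |A i j| ≤ 1)
    {z : Fin m → ℝ} {r : ℝ} (h : ∀ i, |z i| ≤ r) (j : Fin m) : |A.mulVec z j| ≤ m * r := by
  calc |A.mulVec z j| ≤ ∑ i, |A j i * z i| := by
        rw [Matrix.mulVec_eq_sum, Finset.sum_apply]
        simpa [mul_comm] using Finset.abs_sum_le_sum_abs (fun i => A j i * z i) Finset.univ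
    _ ≤ ∑ _i : Fin m, r := by
        refine Finset.sum_le_sum fun i _ => ?_
        rw [abs_mul]
        exact (mul_le_of_le_one_left (abs_nonneg _) (hA j i)).trans (h i)
    _ = m * r := by simp

theorem abs_orthogonalGroup_entry_le_one (U : Matrix.orthogonalGroup (Fin m) ℝ) (i j : Fin m) :
    |(U : Matrix (Fin m) (Fin m) ℝ) i j| ≤ 1 :=
  entry_norm_bound_of_unitary U.2 i j

variable (U : Matrix.orthogonalGroup (Fin m) ℝ) (b : Fin m → ℝ)

theorem affineComponent_id_sub (c c' : Fin d → ℝ) :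
    affineComponent U b id c - affineComponent U b id c' =
      (U : Matrix (Fin m) (Fin m) ℝ).mulVec (zeroPad m c - zeroPad m c') := by
  simp [affineComponent, Matrix.mulVec_sub]

theorem abs_affineComponent_id_sub_le {c c' : Fin d → ℝ} {r : ℝ} (hr : 0 ≤ r)
    (h : ∀ i, |c i - c' i| ≤ r) (j : Fin m) :
    |affineComponent U b id c j - affineComponent U b id c' j| ≤ m * r := by
  rw [← Pi.sub_apply, affineComponent_id_sub]
  exact abs_mulVec_le_of_abs_entry_le_one (abs_orthogonalGroup_entry_le_one U)
    (fun i => abs_zeroPad_sub_le hr h i) j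

/-- The inverse of `U` is its transpose, again orthogonal with entries at most 1. The crude sup-norm
factor `m` suffices, as only independence of `n` matters. -/
theorem abs_sub_le_of_abs_affineComponent_id_sub_le (hd : d ≤ m) {c c' : Fin d → ℝ} {r : ℝ}
    (h : ∀ j, |affineComponent U b id c j - affineComponent U b id c' j| ≤ r) (i : Fin d) :
    |c i - c' i| ≤ m * r := by
  have h1 : (star U : Matrix.orthogonalGroup (Fin m) ℝ).1.mulVec
      (affineComponent U b id c - affineComponent U b id c') = zeroPad m c - zeroPad m c' := by
    rw [affineComponent_id_sub, Matrix.mulVec_mulVec]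
    have : (star U : Matrix.orthogonalGroup (Fin m) ℝ).1 * U.1 = 1 :=
      Matrix.UnitaryGroup.star_mul_self U
    rw [this, Matrix.one_mulVec]
  have h2 := abs_mulVec_le_of_abs_entry_le_one (abs_orthogonalGroup_entry_le_one (star U)) h
    (Fin.castLE hd i)
  change |(star U : Matrix.orthogonalGroup (Fin m) ℝ).1.mulVec
      (affineComponent U b id c - affineComponent U b id c') (Fin.castLE hd i)| ≤ _ at h2
  rw [h1] at h2
  simpa [zeroPad] using h2

/-- The integer vector `(⌊n x₁⌋, …, ⌊n xₘ⌋)`. -/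
noncomputable def floorVec (n : ℕ) (x : Fin m → ℝ) : Fin m → ℤ := fun j => ⌊(n : ℝ) * x j⌋

theorem abs_sub_le_of_floorVec_eq {n : ℕ} (hn : 1 ≤ n) {x y : Fin m → ℝ}
    (h : floorVec n x = floorVec n y) (j : Fin m) : |x j - y j| ≤ 1 / n := by
  have hn' : (0 : ℝ) < n := by exact_mod_cast hn
  have := Int.abs_sub_lt_one_of_floor_eq_floor (congrFun h j)
  rw [← mul_sub, abs_mul, abs_of_pos hn'] at this
  rw [le_div_iff₀ hn']
  linarith

/-- The preimage of a cube lies in a sup-norm ball of radius `m / n`. The base is `2 * m + 1` rather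
than `2 * m` so that it is at least 1 and the exponent `d` can be raised to `m`, making the constant
uniform in `d`. -/
theorem volume_floorVec_affineComponent_eq_le (hd : d ≤ m) {n : ℕ} (hn : 1 ≤ n)
    (k : Fin m → ℤ) :
    volume {c : Fin d → ℝ | floorVec n (affineComponent U b id c) = k} ≤
      ENNReal.ofReal ((2 * m + 1) ^ m / n ^ d) := by
  rcases Set.eq_empty_or_nonempty {c : Fin d → ℝ | floorVec n (affineComponent U b id c) = k} with
    h | ⟨c₀, h₀⟩
  · simp [h]
  have hr : (0 : ℝ) ≤ m * (1 / n) := by positivity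
  calc _ ≤ volume (Metric.closedBall c₀ (m * (1 / n) : ℝ)) := by
        refine measure_mono fun c hc => ?_
        rw [Metric.mem_closedBall, dist_pi_le_iff hr]
        exact abs_sub_le_of_abs_affineComponent_id_sub_le U b hd
          (abs_sub_le_of_floorVec_eq hn (Eq.trans hc (Eq.symm h₀)))
    _ = ENNReal.ofReal ((2 * (m * (1 / n))) ^ d) := by
        rw [Real.volume_pi_closedBall _ hr, Fintype.card_fin]
    _ ≤ _ := by
        refine ENNReal.ofReal_le_ofReal ?_
        rw [show (2 * (m * (1 / n)) : ℝ) = 2 * m / n by ring, div_pow]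
        gcongr
        calc (2 * m : ℝ) ^ d ≤ (2 * m + 1) ^ d := by gcongr; linarith
          _ ≤ (2 * m + 1) ^ m := pow_le_pow_right₀ (by linarith [(Nat.cast_nonneg m : (0:ℝ) ≤ m)]) hd

theorem abs_floor_sub_floor_le {x y : ℝ} {N : ℕ} (h : |x - y| ≤ N) : |⌊x⌋ - ⌊y⌋| ≤ (N : ℤ) + 1 := by
  rw [abs_le] at h ⊢
  have h1 := Int.floor_le x
  have h2 := Int.lt_floor_add_one x
  have h3 := Int.floor_le y
  have h4 := Int.lt_floor_add_one y
  constructor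
  · have : ((-((N : ℤ) + 1) : ℤ) : ℝ) < ((⌊x⌋ - ⌊y⌋ + 1 : ℤ) : ℝ) := by push_cast; linarith
    have := Int.cast_lt.1 this
    omega
  · have : ((⌊x⌋ - ⌊y⌋ : ℤ) : ℝ) < (((N : ℤ) + 1 + 1 : ℤ) : ℝ) := by push_cast; linarith
    have := Int.cast_lt.1 this
    omega

/-- The number of cubes of side `1 / n` inside a unit cube that meet a `d`-dimensional affine
subspace of `ℝᵐ` is at most a constant times `n ^ d`. -/
theorem exists_finset_floorVec_affineComponent_mem (hd : d ≤ m) {n : ℕ} (hn : 1 ≤ n)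
    (k : Fin m → ℤ) :
    ∃ F : Finset (Fin m → ℤ), (F.card : ℝ) ≤ (2 * m + 3) ^ (2 * m) * n ^ d ∧
      ∀ c : Fin d → ℝ, floorVec 1 (affineComponent U b id c) = k →
        floorVec n (affineComponent U b id c) ∈ F := by
  classical
  by_cases hex : ∃ c₀ : Fin d → ℝ, floorVec 1 (affineComponent U b id c₀) = k
  swap
  · exact ⟨∅, by simp; positivity, fun c hc => absurd ⟨c, hc⟩ hex⟩
  obtain ⟨c₀, hc₀⟩ := hex
  have hn' : (0 : ℝ) < n := by exact_mod_cast hn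
  -- All admissible `c` lie within `m` of `c₀`, so `P` contains the floors of `n c`. Rounding `c` to
  -- the grid moves the image by at most `m / n`, shifting its cube index by at most `m + 1` per
  -- coordinate: `Q` holds these shifts.
  set P : Finset (Fin d → ℤ) := Fintype.piFinset fun i =>
    Finset.Icc (floorVec n c₀ i - (n * m + 1)) (floorVec n c₀ i + (n * m + 1)) with hP
  set Q : Finset (Fin m → ℤ) := Fintype.piFinset fun _ => Finset.Icc (-((m : ℤ) + 1)) (m + 1) with hQ
  let w : (Fin d → ℤ) → Fin m → ℤ := fun l =>
    floorVec n (affineComponent U b id fun i => (l i : ℝ) / n)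
  refine ⟨(P ×ˢ Q).image fun t => w t.1 + t.2, ?_, ?_⟩
  · have hPc : P.card = (2 * (n * m) + 3) ^ d := by
      rw [hP, Fintype.card_piFinset, Finset.prod_congr rfl (g := fun _ => 2 * (n * m) + 3)]
      · simp
      · intro i _
        rw [Int.card_Icc]
        have : floorVec n c₀ i + (n * m + 1) + 1 - (floorVec n c₀ i - (n * m + 1)) =
            ((2 * (n * m) + 3 : ℕ) : ℤ) := by push_cast; ring
        rw [this, Int.toNat_natCast]
    have hQc : Q.card = (2 * m + 3) ^ m := by
      rw [hQ, Fintype.card_piFinset, Int.card_Icc]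
      simp only [Finset.prod_const, Finset.card_univ, Fintype.card_fin]
      congr 1
      omega
    have h1 : ((P ×ˢ Q).image fun t => w t.1 + t.2).card ≤ (2 * m + 3) ^ (2 * m) * n ^ d := by
      refine Finset.card_image_le.trans ?_
      rw [Finset.card_product, hPc, hQc]
      calc (2 * (n * m) + 3) ^ d * (2 * m + 3) ^ m
          ≤ ((2 * m + 3) * n) ^ d * (2 * m + 3) ^ m := by
            gcongr
            nlinarith
        _ = (2 * m + 3) ^ d * n ^ d * (2 * m + 3) ^ m := by rw [mul_pow]
        _ ≤ (2 * m + 3) ^ m * n ^ d * (2 * m + 3) ^ m := by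
            gcongr
            omega
        _ = (2 * m + 3) ^ (2 * m) * n ^ d := by ring
    exact_mod_cast h1
  · intro c hc
    have h1 : ∀ i, |c i - c₀ i| ≤ m := by
      have := abs_sub_le_of_abs_affineComponent_id_sub_le U b hd
        (abs_sub_le_of_floorVec_eq le_rfl (hc.trans hc₀.symm))
      simpa using this
    refine Finset.mem_image.2 ⟨(floorVec n c,
      floorVec n (affineComponent U b id c) - w (floorVec n c)), ?_, by simp⟩
    rw [Finset.mem_product]
    constructor
    · rw [hP, Fintype.mem_piFinset]
      intro i
      have h2 : |(n : ℝ) * c i - n * c₀ i| ≤ (n * m : ℕ) := by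
        rw [← mul_sub, abs_mul, abs_of_pos hn']
        push_cast
        exact mul_le_mul_of_nonneg_left (h1 i) hn'.le
      have h3 := abs_le.1 (abs_floor_sub_floor_le h2)
      push_cast at h3
      simp only [Finset.mem_Icc, floorVec]
      constructor <;> linarith [h3.1, h3.2]
    · rw [hQ, Fintype.mem_piFinset]
      intro j
      have h2 : ∀ i, |c i - (floorVec n c i : ℝ) / n| ≤ 1 / n := by
        intro i
        have h4 := Int.floor_le ((n : ℝ) * c i)
        have h5 := Int.lt_floor_add_one ((n : ℝ) * c i)
        have h6 : c i - (floorVec n c i : ℝ) / n = (n * c i - ⌊(n : ℝ) * c i⌋) / n := by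
          simp only [floorVec]
          field_simp
        rw [h6, abs_div, abs_of_pos hn', abs_of_nonneg (by linarith)]
        gcongr
        linarith
      have h3 := abs_affineComponent_id_sub_le U b (by positivity) h2 j
      have h4 := mul_le_mul_of_nonneg_left h3 hn'.le
      rw [show (n : ℝ) * (m * (1 / n)) = m by field_simp, ← abs_of_pos hn', ← abs_mul, mul_sub,
        abs_of_pos hn'] at h4
      have h5 := abs_le.1 (abs_floor_sub_floor_le h4)
      simp only [Finset.mem_Icc, Pi.sub_apply, w]
      exact h5

end Geometry

/-! ### Quantization through integer indices. -/

section Quantization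

theorem measurable_floorVec {m : ℕ} (n : ℕ) : Measurable (floorVec n : (Fin m → ℝ) → Fin m → ℤ) :=
  measurable_pi_lambda _ fun j => ((measurable_pi_apply j).const_mul _).floor

/-- Unit cubes are unions of cubes of side `1 / n`: the coarse index is a function of the fine one.
-/
theorem floorVec_one_eq_ediv {m : ℕ} {n : ℕ} (hn : 1 ≤ n) (x : Fin m → ℝ) :
    floorVec 1 x = fun j => floorVec n x j / (n : ℤ) := by
  funext j
  have hn' : (n : ℝ) ≠ 0 := by positivity
  simp only [floorVec, ← Int.floor_div_natCast]
  congr 1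
  field_simp
  simp

/-- Entropy sees only the partition; integer indices live in a countable type, as the entropy lemmas
require. -/
theorem shannonEntropy_quantize {Ω : Type*} [MeasurableSpace Ω] (μ : Measure Ω) {m n : ℕ}
    (hn : 1 ≤ n) (X : Ω → Fin m → ℝ) :
    shannonEntropy μ (fun ω => quantize n (X ω)) =
      shannonEntropy μ (fun ω => floorVec n (X ω)) := by
  have hn' : (n : ℝ) ≠ 0 := by positivity
  have hg : Function.Injective (fun (k : Fin m → ℤ) (j : Fin m) => (k j : ℝ) / n) := by
    intro k k' h
    funext j
    have := congrFun h j
    simp only [div_left_inj' hn', Int.cast_inj] at this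
    exact this
  exact shannonEntropy_comp_of_injective μ (fun ω => floorVec n (X ω)) hg

end Quantization

/-! ### The two entropy bounds for the mixture. -/

section AffinelySingular

variable {Ω : Type*} {m : ℕ} {V : Ω → ℕ} {d : ℕ → ℕ}
  {U : ℕ → Matrix.orthogonalGroup (Fin m) ℝ} {b : ℕ → Fin m → ℝ}
  {C : (i : ℕ) → Ω → Fin (d i) → ℝ}

theorem affinelySingularVector_apply (ω : Ω) :
    affinelySingularVector V d U b C ω =
      affineComponent (U (V ω)) (b (V ω)) id (C (V ω) ω) := by
  unfold affinelySingularVector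
  rw [tsum_eq_single (V ω)]
  · simp [affineComponent]
  · intro i hi
    rw [Set.indicator_of_notMem]
    exact fun h => hi (Eq.symm h)

variable [MeasurableSpace Ω]

theorem measurable_affineComponent_id {d : ℕ} (U : Matrix.orthogonalGroup (Fin m) ℝ)
    (b : Fin m → ℝ) : Measurable (affineComponent U b (id : (Fin d → ℝ) → Fin d → ℝ)) := by
  refine Continuous.measurable ?_
  have hz : Continuous (zeroPad m : (Fin d → ℝ) → Fin m → ℝ) := by
    refine continuous_pi fun j => ?_
    unfold zeroPad
    split_ifs
    · exact continuous_apply _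
    · exact continuous_const
  unfold affineComponent
  exact (Continuous.matrix_mulVec continuous_const hz).add continuous_const

theorem measurable_affinelySingularVector (hV : Measurable V) (hC : ∀ i, Measurable (C i)) :
    Measurable (affinelySingularVector V d U b C) := by
  have h : Measurable fun p : ℕ × Ω => affineComponent (U p.1) (b p.1) id (C p.1 p.2) :=
    measurable_from_prod_countable_right fun i =>
      (measurable_affineComponent_id (U i) (b i)).comp (hC i)
  have h2 : affinelySingularVector V d U b C =
      fun ω => affineComponent (U (V ω)) (b (V ω)) id (C (V ω) ω) :=
    funext affinelySingularVector_apply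
  rw [h2]
  exact h.comp (hV.prodMk measurable_id)

variable (μ : Measure Ω) [IsProbabilityMeasure μ]

theorem shannonEntropy_floorVec_affinelySingularVector_le (hV : Measurable V) (hd : ∀ i, d i ≤ m)
    (hC : ∀ i, Measurable (C i)) {n : ℕ} (hn : 1 ≤ n) :
    shannonEntropy μ (fun ω => floorVec n (affinelySingularVector V d U b C ω)) ≤
      shannonEntropy μ V +
        shannonEntropy μ (fun ω => floorVec 1 (affinelySingularVector V d U b C ω)) +
        ENNReal.ofReal (Real.log ((2 * m + 3) ^ (2 * m))) +
        (∫⁻ ω, (d (V ω) : ℝ≥0∞) ∂μ) * ENNReal.ofReal (Real.log n) := by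
  have hZ : Measurable (affinelySingularVector V d U b C) :=
    measurable_affinelySingularVector hV hC
  have hK : ∀ n, Measurable fun ω => floorVec n (affinelySingularVector V d U b C ω) :=
    fun n => (measurable_floorVec n).comp hZ
  choose F hFc hF using fun s : ℕ × (Fin m → ℤ) =>
    exists_finset_floorVec_affineComponent_mem (U s.1) (b s.1) (hd s.1) hn s.2
  have hn1 : (1 : ℝ) ≤ n := by exact_mod_cast hn
  have hn0 : (0 : ℝ) < n := by linarith
  have hB : (1 : ℝ) ≤ (2 * m + 3) ^ (2 * m) :=
    one_le_pow₀ (by linarith [(Nat.cast_nonneg m : (0 : ℝ) ≤ m)])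
  set Y : Ω → ℕ × (Fin m → ℤ) := fun ω =>
    (V ω, floorVec n (affinelySingularVector V d U b C ω)) with hYdef
  have hY : Measurable Y := hV.prodMk (hK n)
  let g : ℕ × (Fin m → ℤ) → ℕ × (Fin m → ℤ) := fun t => (t.1, fun j => t.2 j / (n : ℤ))
  have hgY : ∀ ω, g (Y ω) = (V ω, floorVec 1 (affinelySingularVector V d U b C ω)) :=
    fun ω => by simp only [g, hYdef, ← floorVec_one_eq_ediv hn]
  calc shannonEntropy μ (fun ω => floorVec n (affinelySingularVector V d U b C ω))
      -- Retaining `V` identifies the affine piece, hence the exponent in the cube count.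
      ≤ shannonEntropy μ Y := shannonEntropy_comp_le μ hY Prod.snd
    _ ≤ shannonEntropy μ (fun ω => g (Y ω)) +
        ∫⁻ ω, ENNReal.ofReal (Real.log ((2 * m + 3) ^ (2 * m) * n ^ d (g (Y ω)).1)) ∂μ := by
        refine shannonEntropy_le_comp_add_log_card μ hY g
          (fun s => (F s).map ⟨fun k => (s.1, k), Prod.mk_right_injective s.1⟩)
          (fun s => (2 * m + 3) ^ (2 * m) * n ^ d s.1)
          (fun s => one_le_mul_of_one_le_of_one_le hB (one_le_pow₀ hn1)) ?_ ?_
        · intro s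
          rw [Finset.card_map]
          exact hFc s
        · intro ω
          rw [hgY, Finset.mem_map]
          refine ⟨_, hF (V ω, floorVec 1 (affinelySingularVector V d U b C ω)) (C (V ω) ω) ?_, ?_⟩
          · simp only [affinelySingularVector_apply]
          · simp only [hYdef, affinelySingularVector_apply, Function.Embedding.coeFn_mk]
    _ ≤ _ := by
        simp_rw [hgY]
        rw [add_assoc]
        refine add_le_add (shannonEntropy_prodMk_le μ hV (hK 1)) (le_of_eq ?_)
        have : ∀ ω, ENNReal.ofReal (Real.log ((2 * m + 3) ^ (2 * m) * n ^ d (V ω))) =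
            ENNReal.ofReal (Real.log ((2 * m + 3) ^ (2 * m))) +
              (d (V ω) : ℝ≥0∞) * ENNReal.ofReal (Real.log n) := by
          intro ω
          rw [Real.log_mul (by positivity) (by positivity), Real.log_pow _ (d (V ω)),
            ENNReal.ofReal_add (Real.log_nonneg hB)
              (mul_nonneg (Nat.cast_nonneg _) (Real.log_nonneg hn1)),
            ENNReal.ofReal_mul (Nat.cast_nonneg _), ENNReal.ofReal_natCast]
        simp_rw [this]
        rw [lintegral_add_left measurable_const, lintegral_const, measure_univ, mul_one,
          lintegral_mul_const]
        exact (measurable_of_countable fun i => (d i : ℝ≥0∞)).comp hV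

/-- The event that the density of `C i`, evaluated at `C i`, is at most `M`, where `i = V`. -/
def densityLeEvent (μ : Measure Ω) (V : Ω → ℕ) (C : (i : ℕ) → Ω → Fin (d i) → ℝ) (M : ℕ) : Set Ω :=
  {ω | (μ.map (C (V ω))).rnDeriv volume (C (V ω) ω) ≤ M}

/-- On `V = i` the event is expressed through `C i` alone, and the constraint on `V` is then
dropped; hence no independence is needed. What remains is a density at most `M` integrated over a
small cell. -/
theorem measure_densityLeEvent_le (hd : ∀ i, d i ≤ m) (hC : ∀ i, Measurable (C i))
    (hCac : ∀ i, (μ.map (C i)).AbsolutelyContinuous volume) {n : ℕ} (hn : 1 ≤ n) (M i : ℕ)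
    (k : Fin m → ℤ) :
    μ ((fun ω => (V ω, floorVec n (affinelySingularVector V d U b C ω))) ⁻¹' {(i, k)} ∩
      densityLeEvent μ V C M) ≤ ENNReal.ofReal (M * ((2 * m + 1) ^ m / n ^ d i)) := by
  set f := (μ.map (C i)).rnDeriv volume with hf
  set B : Set (Fin (d i) → ℝ) := {c | floorVec n (affineComponent (U i) (b i) id c) = k} with hB
  have hBm : MeasurableSet B :=
    ((measurable_floorVec n).comp (measurable_affineComponent_id (U i) (b i)))
      (measurableSet_singleton k)
  have hfm : MeasurableSet {c | f c ≤ M} :=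
    measurableSet_le (Measure.measurable_rnDeriv _ _) measurable_const
  calc _ ≤ μ (C i ⁻¹' (B ∩ {c | f c ≤ M})) := by
        refine measure_mono ?_
        rintro ω ⟨h1, h2⟩
        simp only [Set.mem_preimage, Set.mem_singleton_iff, Prod.mk.injEq,
          affinelySingularVector_apply] at h1
        obtain ⟨rfl, h1⟩ := h1
        exact ⟨h1, h2⟩
    _ = ∫⁻ c in B ∩ {c | f c ≤ M}, f c := by
        rw [← Measure.map_apply (hC i) (hBm.inter hfm), hf,
          Measure.setLIntegral_rnDeriv (hCac i)]
    _ ≤ ∫⁻ _ in B ∩ {c | f c ≤ M}, (M : ℝ≥0∞) :=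
        setLIntegral_mono' (hBm.inter hfm) fun c hc => hc.2
    _ ≤ M * volume B := by
        rw [setLIntegral_const]
        gcongr
        exact Set.inter_subset_left
    _ ≤ M * ENNReal.ofReal ((2 * m + 1) ^ m / n ^ d i) := by
        gcongr
        exact volume_floorVec_affineComponent_eq_le (U i) (b i) (hd i) hn k
    _ = _ := by rw [ENNReal.ofReal_mul (Nat.cast_nonneg M), ENNReal.ofReal_natCast]

theorem setLIntegral_densityLeEvent_mul_log_le (hV : Measurable V) (hd : ∀ i, d i ≤ m)
    (hC : ∀ i, Measurable (C i)) (hCac : ∀ i, (μ.map (C i)).AbsolutelyContinuous volume)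
    {n : ℕ} (hn : 1 ≤ n) {M : ℕ} (hM : 1 ≤ M) :
    (∫⁻ ω in densityLeEvent μ V C M, (d (V ω) : ℝ≥0∞) ∂μ) * ENNReal.ofReal (Real.log n) ≤
      shannonEntropy μ (fun ω => floorVec n (affinelySingularVector V d U b C ω)) +
        (shannonEntropy μ V + 1 + ENNReal.ofReal (Real.log (M * (2 * m + 1) ^ m))) := by
  have hZ : Measurable (affinelySingularVector V d U b C) :=
    measurable_affinelySingularVector hV hC
  have hK : Measurable fun ω => floorVec n (affinelySingularVector V d U b C ω) :=
    (measurable_floorVec n).comp hZ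
  have hn1 : (1 : ℝ) ≤ n := by exact_mod_cast hn
  have hn0 : (0 : ℝ) < n := by linarith
  have hM1 : (1 : ℝ) ≤ M := by exact_mod_cast hM
  have hB : (1 : ℝ) ≤ M * (2 * m + 1) ^ m := one_le_mul_of_one_le_of_one_le hM1
    (one_le_pow₀ (by linarith [(Nat.cast_nonneg m : (0 : ℝ) ≤ m)]))
  have h := setLIntegral_le_shannonEntropy_add μ (hV.prodMk hK) (A := densityLeEvent μ V C M)
    (fun t => d t.1 * Real.log n) (fun t => mul_nonneg (Nat.cast_nonneg _) (Real.log_nonneg hn1))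
    (Real.log_nonneg hB) ?_
  · simp_rw [ENNReal.ofReal_mul (Nat.cast_nonneg _), ENNReal.ofReal_natCast] at h
    have hdV : Measurable fun ω => (d (V ω) : ℝ≥0∞) :=
      (measurable_of_countable fun i => (d i : ℝ≥0∞)).comp hV
    rw [lintegral_mul_const _ hdV] at h
    refine h.trans ?_
    calc _ ≤ shannonEntropy μ V +
          shannonEntropy μ (fun ω => floorVec n (affinelySingularVector V d U b C ω)) + 1 +
          ENNReal.ofReal (Real.log (M * (2 * m + 1) ^ m)) := by
          gcongr
          exact shannonEntropy_prodMk_le μ hV hK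
      _ = _ := by ring
  · rintro ⟨i, k⟩
    -- With `c = log (M (2m+1)^m)` and `D = d i * log n`, the bound `exp (c - D)` is the cell
    -- estimate.
    rw [Real.exp_sub, Real.exp_log (by linarith), ← Real.log_pow, Real.exp_log (by positivity),
      mul_div_assoc]
    exact ENNReal.toReal_le_of_le_ofReal (by positivity)
      (measure_densityLeEvent_le μ hd hC hCac hn M i k)

/-- Each density is Lebesgue-a.e. finite, hence by absolute continuity finite at `C i` almost
surely, for all countably many `i` at once. -/
theorem iSup_setLIntegral_densityLeEvent (hC : ∀ i, Measurable (C i))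
    (hCac : ∀ i, (μ.map (C i)).AbsolutelyContinuous volume) (f : Ω → ℝ≥0∞) :
    ⨆ M, ∫⁻ ω in densityLeEvent μ V C M, f ω ∂μ = ∫⁻ ω, f ω ∂μ := by
  have hmono : Monotone (densityLeEvent μ V C) := by
    intro M N hMN ω hω
    exact le_trans (show _ ≤ (M : ℝ≥0∞) from hω) (by exact_mod_cast hMN)
  rw [← setLIntegral_iUnion_of_directed f (directed_of_isDirected_le hmono)]
  have : ∀ᵐ ω ∂μ, ω ∈ ⋃ M, densityLeEvent μ V C M := by
    have h1 : ∀ i, ∀ᵐ ω ∂μ, (μ.map (C i)).rnDeriv volume (C i ω) < ∞ := fun i =>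
      ae_of_ae_map (hC i).aemeasurable
        ((hCac i).ae_le (Measure.rnDeriv_lt_top (μ.map (C i)) volume))
    filter_upwards [ae_all_iff.2 h1] with ω hω
    obtain ⟨M, hM⟩ := ENNReal.exists_nat_gt (hω (V ω)).ne
    exact Set.mem_iUnion.2 ⟨M, hM.le⟩
  rw [Measure.restrict_eq_self_of_ae_mem this]

end AffinelySingular

/-! ### Passage to the limit. -/

theorem tendsto_const_div_ofReal_log_atTop {c : ℝ≥0∞} (hc : c ≠ ∞) :
    Tendsto (fun n : ℕ => c / ENNReal.ofReal (Real.log n)) atTop (𝓝 0) := by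
  have h : Tendsto (fun n : ℕ => ENNReal.ofReal (Real.log n)) atTop (𝓝 ∞) :=
    ENNReal.tendsto_ofReal_atTop.comp (Real.tendsto_log_atTop.comp tendsto_natCast_atTop_atTop)
  simpa using ENNReal.Tendsto.const_div h (Or.inr hc)

theorem mainTheorem2 {Ω : Type*} [MeasurableSpace Ω] (μ : Measure Ω) [IsProbabilityMeasure μ]
    (m : ℕ) (V : Ω → ℕ) (hV : Measurable V)
    (d : ℕ → ℕ) (hd : ∀ i, d i ≤ m)
    (U : ℕ → Matrix.orthogonalGroup (Fin m) ℝ) (b : ℕ → Fin m → ℝ)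
    (C : (i : ℕ) → Ω → Fin (d i) → ℝ) (hC : ∀ i, Measurable (C i))
    (hCac : ∀ i, (μ.map (C i)).AbsolutelyContinuous volume)
    (hHV : shannonEntropy μ V < ∞)
    (hHZ : shannonEntropy μ (fun ω => quantize 1 (affinelySingularVector V d U b C ω)) < ∞) :
    HasInformationDimension μ (affinelySingularVector V d U b C)
      (∫⁻ ω, (d (V ω) : ℝ≥0∞) ∂μ) := by
  rw [shannonEntropy_quantize μ le_rfl] at hHZ
  -- For `n = 0, 1` the denominator is 0, so only `n ≥ 2` is used.
  have hlog : ∀ n : ℕ, 2 ≤ n →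
      ENNReal.ofReal (Real.log n) ≠ 0 ∧ ENNReal.ofReal (Real.log n) ≠ ∞ := fun n hn =>
    ⟨(ENNReal.ofReal_pos.2 (Real.log_pos (by exact_mod_cast hn))).ne', ENNReal.ofReal_ne_top⟩
  refine tendsto_order.2 ⟨fun a ha => ?_, fun a ha => ?_⟩
  · rw [← iSup_setLIntegral_densityLeEvent (V := V) μ hC hCac] at ha
    obtain ⟨M, hM⟩ := lt_iSup_iff.1 ha
    -- Passing to `M + 1` ensures a truncation level at least 1, so that the logarithm in the
    -- constant is nonnegative.
    have hM' : a < ∫⁻ ω in densityLeEvent μ V C (M + 1), (d (V ω) : ℝ≥0∞) ∂μ := by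
      refine hM.trans_le (lintegral_mono_set ?_)
      intro ω hω
      exact le_trans (show _ ≤ (M : ℝ≥0∞) from hω) (by exact_mod_cast M.le_succ)
    set c : ℝ≥0∞ := shannonEntropy μ V + 1 +
      ENNReal.ofReal (Real.log ((M + 1 : ℕ) * (2 * m + 1) ^ m)) with hc
    have hc' : c ≠ ∞ := 
      ENNReal.add_ne_top.2 ⟨ENNReal.add_ne_top.2 ⟨hHV.ne, ENNReal.one_ne_top⟩, ENNReal.ofReal_ne_top⟩
    have ht := ENNReal.Tendsto.sub (tendsto_const_nhds
      (x := ∫⁻ ω in densityLeEvent μ V C (M + 1), (d (V ω) : ℝ≥0∞) ∂μ))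
      (tendsto_const_div_ofReal_log_atTop hc') (Or.inr ENNReal.zero_ne_top)
    rw [tsub_zero] at ht
    filter_upwards [ht.eventually (lt_mem_nhds hM'), eventually_ge_atTop 2] with n h1 h2
    refine h1.trans_le ?_
    rw [tsub_le_iff_right, shannonEntropy_quantize μ (by omega), ENNReal.div_add_div_same,
      ENNReal.le_div_iff_mul_le (Or.inl (hlog n h2).1) (Or.inl (hlog n h2).2)]
    exact setLIntegral_densityLeEvent_mul_log_le μ hV hd hC hCac (by omega) (by omega)
  · set c : ℝ≥0∞ := shannonEntropy μ V +
      shannonEntropy μ (fun ω => floorVec 1 (affinelySingularVector V d U b C ω)) +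
      ENNReal.ofReal (Real.log ((2 * m + 3) ^ (2 * m))) with hc
    have hc' : c ≠ ∞ := 
      ENNReal.add_ne_top.2 ⟨ENNReal.add_ne_top.2 ⟨hHV.ne, hHZ.ne⟩, ENNReal.ofReal_ne_top⟩
    have ht := (tendsto_const_div_ofReal_log_atTop hc').add (tendsto_const_nhds
      (x := ∫⁻ ω, (d (V ω) : ℝ≥0∞) ∂μ))
    rw [zero_add] at ht
    filter_upwards [ht.eventually (gt_mem_nhds ha), eventually_ge_atTop 2] with n h1 h2
    refine lt_of_le_of_lt ?_ h1
    rw [shannonEntropy_quantize μ (by omega)]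
    refine ENNReal.div_le_of_le_mul ?_
    rw [add_mul, ENNReal.div_mul_cancel (hlog n h2).1 (hlog n h2).2]
    exact shannonEntropy_floorVec_affinelySingularVector_le μ hV hd hC (by omega)
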